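/- All graphs are finite and simple. For a graph $T$, a set $D\subseteq V(T)$ is a dominating set if every vertex not in $D$ is adjacent to a vertex in $D$; a dominating set of minimum cardinality is called a $\gamma$-set. The $\gamma$-graph $T(\gamma)$ is the graph whose vertices are the $\gamma$-sets of $T$, two $\gamma$-sets $D_1,D_2$ being adjacent if there are $u\in D_1$ and $v\in D_2$ with $uv\in E(T)$ and $D_2=(D_1\setminus\{u\})\cup\{v\}$. Let $H$ be the tree on six vertices that consists of two adjacent vertices, each of which is adjacent to two further vertices, which are leaves. Theorem. Let $G$ be a tree. Then $G$ is (isomorphic to) the $\gamma$-graph of some tree if and only if $H$ is not (isomorphic to) a subtree of $G$. Equivalently, $G$ is the $\gamma$-graph of some tree if and only if no two adjacent vertices of $G$ both have degree at least three. -/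

import Mathlib

namespace SimpleGraph

variable {V : Type*}

/-- `D` is a dominating set of `G`: every vertex not in `D` is adjacent to a vertex in `D`. -/
def IsDominating (G : SimpleGraph V) (D : Finset V) : Prop :=
  ∀ v, v ∉ D → ∃ u ∈ D, G.Adj v u

/-- `D` is a `γ`-set of `G`: a dominating set of minimum cardinality. -/
def IsGammaSet (G : SimpleGraph V) (D : Finset V) : Prop :=
  G.IsDominating D ∧ ∀ D' : Finset V, G.IsDominating D' → D.card ≤ D'.card

/-- The `γ`-graph of `G`: its vertices are the `γ`-sets of `G`, and `D₁`, `D₂` are adjacent if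
`D₂ = (D₁ - {u}) ∪ {v}` for some `u ∈ D₁` and `v ∈ D₂` that are adjacent in `G`. -/
def gammaGraph [DecidableEq V] (G : SimpleGraph V) :
    SimpleGraph {D : Finset V // G.IsGammaSet D} where
  Adj D₁ D₂ := ∃ u ∈ D₁.1, ∃ v ∈ D₂.1, G.Adj u v ∧ D₂.1 = D₁.1.erase u ∪ {v}
  symm := ⟨by
    rintro ⟨D₁, h₁⟩ ⟨D₂, h₂⟩ ⟨u, hu, v, hv, huv, h⟩
    dsimp only at hu hv h
    refine ⟨v, hv, u, hu, huv.symm, ?_⟩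
    have hcard : D₁.card = D₂.card := le_antisymm (h₁.2 _ h₂.1) (h₂.2 _ h₁.1)
    have hv₁ : v ∉ D₁ := by
      intro hv₁
      have hmem : v ∈ D₁.erase u := Finset.mem_erase.2 ⟨huv.ne', hv₁⟩
      have h' : D₂ = D₁.erase u := by
        rw [h]
        exact Finset.union_eq_left.2 (Finset.singleton_subset_iff.2 hmem)
      have hlt := Finset.card_erase_lt_of_mem hu
      rw [← h'] at hlt
      omega
    dsimp only
    ext w
    simp only [h, Finset.mem_union, Finset.mem_erase, Finset.mem_singleton]
    by_cases hwu : w = u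
    · subst hwu
      simp [hu]
    · by_cases hwv : w = v
      · subst hwv
        simp [hv₁, hwu]
      · simp [hwu, hwv]⟩
  loopless := ⟨by
    rintro ⟨D, hD⟩ ⟨u, hu, v, hv, huv, h⟩
    dsimp only at hu hv h
    rw [h] at hu
    simp [huv.ne] at hu⟩

/-- `G` is (isomorphic to) the `γ`-graph of some finite tree. -/
def IsGammaGraphOfTree (G : SimpleGraph V) : Prop :=
  ∃ (W : Type) (_ : Fintype W) (_ : DecidableEq W) (T : SimpleGraph W),
    T.IsTree ∧ Nonempty (G ≃g T.gammaGraph)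

/-- The tree `H` on six vertices: two adjacent vertices `0`, `1`, where `0` has the further leaves
`2`, `3`, and `1` has the further leaves `4`, `5`. -/
def treeH : SimpleGraph (Fin 6) :=
  fromEdgeSet {s(0, 1), s(0, 2), s(0, 3), s(1, 4), s(1, 5)}

end SimpleGraph

/-! View a `γ`-set as a placement of tokens; an edge of the `γ`-graph slides one token.

Necessity. A `γ`-graph that is a tree has no 4-cycle, so the slides of two different tokens cannot
both be carried out: some vertex adjacent to both old positions would be left undominated
(`IsMove.exists_block`). In a tree `T` this means that a token with two slides is the only movable
one (`IsMove.eq_of_two`) and that three tokens are never movable (`IsMove.not_three`). So at a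
`γ`-set with three neighbours a single token makes all the slides; its position is dominated by it
alone and is its only private neighbour. If both ends of a slide from `u` to `v` had three
neighbours, the tokens at rest would not dominate `u` (seen from the first end), yet would dominate
everything except `v` (seen from the second): `gammaGraph_not_adj_of_three`.

Sufficiency. Let `B` be the set of vertices with three neighbours, which is independent. Encode a
vertex `r` by orienting all edges towards `r`. These are exactly the orientations with out-degrees
at most one (`IsTree.exists_root_of_orientation`), and moving the root along an edge reverses only
that edge. In `gadget`, an edge with no end in `B` is subdivided twice and carries one token, next
to its head. An edge at `x` in `B` is subdivided once, and `x` shares a single token with its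
neighbours: it marks the out-edge of `x`, or sits on `x` if `x` is the root. Thus the out-degree
bound is built in on `B`; at a vertex of degree two it says that the vertex is dominated. Pendant
stars dominate the vertices where domination would impose an unwanted condition. A packing with one
center per token identifies the `γ`-sets (`IsPacking.isGammaSet_iff`, `eq_tokenSet_of_isTight`). -/

namespace SimpleGraph

/-! ### Distances, roots and orientations in trees. -/

section TreeDistance

variable {V : Type*} {G : SimpleGraph V}

/-- In a tree, every vertex has at most one neighbour that is closer to a given root. -/
theorem IsTree.closer_unique (hG : G.IsTree) (r : V) {x y z : V} (hxy : G.Adj x y)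
    (hxz : G.Adj x z) (hy : G.dist r y < G.dist r x) (hz : G.dist r z < G.dist r x) : y = z := by
  classical
  obtain ⟨p, hp, -⟩ := (hG.connected r x).exists_path_of_dist
  have key : ∀ w, G.Adj x w → G.dist r w < G.dist r x → w = p.penultimate := by
    intro w hxw hw
    obtain ⟨q, hq, hql⟩ := (hG.connected r w).exists_path_of_dist
    refine hG.isAcyclic.eq_penultimate_of_adj_end hp hxw
      (hG.isAcyclic.mem_support_of_ne_mem_support_of_adj_of_isPath hp hq hxw fun hx => ?_)
    have h1 := dist_le (q.takeUntil x hx)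
    have h2 := q.length_takeUntil_le_length hx
    omega
  rw [key y hxy hy, key z hxz hz]

/-- In a connected graph, every vertex other than the root has a neighbour closer to the root. -/
theorem Connected.exists_closer (hG : G.Connected) {r x : V} (h : x ≠ r) :
    ∃ y, G.Adj x y ∧ G.dist r y < G.dist r x := by
  obtain ⟨p, hp⟩ := hG.exists_walk_length_eq_dist x r
  cases p with
  | nil => exact absurd rfl h
  | cons hadj q =>
    rename_i y
    refine ⟨y, hadj, ?_⟩
    have := dist_le q
    rw [Walk.length_cons, dist_comm] at hp
    rw [dist_comm] at this
    omega

theorem IsTree.closer_or_closer (hG : G.IsTree) (r : V) {x y : V} (h : G.Adj x y) :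
    G.dist r y < G.dist r x ∨ G.dist r x < G.dist r y := by
  have := hG.dist_ne_of_adj r h
  omega

/-- In a tree, two different vertices have at most one common neighbour. -/
theorem IsTree.commonNeighbor_unique (hG : G.IsTree) {a b x y : V} (hab : a ≠ b)
    (hax : G.Adj a x) (hbx : G.Adj b x) (hay : G.Adj a y) (hby : G.Adj b y) : x = y := by
  have h1 := dist_eq_one_iff_adj.2 hax
  have h2 := dist_eq_one_iff_adj.2 hay
  have h3 := hG.connected.pos_dist_of_ne hab
  have h4 := hG.dist_ne_of_adj a hbx
  exact hG.closer_unique a hbx hby (by omega) (by omega)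

theorem IsTree.not_triangle (hG : G.IsTree) {a b c : V} (hab : G.Adj a b) (hac : G.Adj a c) :
    ¬ G.Adj b c := by
  intro h
  have := hG.dist_ne_of_adj a h
  rw [dist_eq_one_iff_adj.2 hab, dist_eq_one_iff_adj.2 hac] at this
  exact this rfl

/-- A tree contains no cycle of length six. -/
theorem IsTree.not_hexagon (hG : G.IsTree) {a b c x y z : V} (hab : a ≠ b) (hac : a ≠ c)
    (hbc : b ≠ c) (hax : G.Adj a x) (hbx : G.Adj b x) (hby : G.Adj b y) (hcy : G.Adj c y)
    (hcz : G.Adj c z) (haz : G.Adj a z) (hxy : x ≠ y) : False := by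
  have h1 := dist_eq_one_iff_adj.2 hax
  have h2 := dist_eq_one_iff_adj.2 haz
  have h3 := hG.connected.pos_dist_of_ne hab
  have h4 := hG.connected.pos_dist_of_ne hac
  have h5 := hG.dist_eq_dist_add_one_of_adj a hbx
  have h6 := hG.dist_eq_dist_add_one_of_adj a hcz
  -- Seen from `a`, both `b` and `c` lie at distance two. So `y` is either the parent of `b`, which
  -- is `x`, or has both `b` and `c` as parents.
  rcases hG.closer_or_closer a hby with h7 | h7
  · exact hxy (hG.closer_unique a hbx hby (by omega) h7)
  · rcases hG.closer_or_closer a hcy with h8 | h8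
    · have := hG.dist_eq_dist_add_one_of_adj a hby
      have := hG.dist_eq_dist_add_one_of_adj a hcy
      omega
    · exact hbc (hG.closer_unique a hby.symm hcy.symm h7 h8)

/-- Moving the root along an edge reverses only that edge. -/
theorem IsTree.closer_of_adj_root (hG : G.IsTree) {r s x y : V} (hrs : G.Adj r s)
    (hxy : G.Adj x y) (hr : G.dist r y < G.dist r x) (hs : G.dist s x < G.dist s y) :
    y = r ∧ x = s := by
  have a1 := dist_eq_one_iff_adj.2 hrs
  have hd : ∀ w, G.dist r w ≤ G.dist s w + 1 ∧ G.dist s w ≤ G.dist r w + 1 := fun w => by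
    have e1 := hG.connected.dist_triangle (u := r) (v := s) (w := w)
    have e2 := hG.connected.dist_triangle (u := s) (v := r) (w := w)
    rw [dist_comm (u := s) (v := r)] at e2
    omega
  have hx := hd x
  have hy := hd y
  by_cases hyr : y = r
  · subst hyr
    refine ⟨rfl, ?_⟩
    rw [dist_self] at hy
    exact (hG.connected.dist_eq_zero_iff.1 (by omega)).symm
  · obtain ⟨z, hyz, hz⟩ := hG.connected.exists_closer hyr
    have hz' := hd z
    have : x = z := by
      -- If `z` were farther from `s` than `y`, the distances from `r` and from `s` would change by
      -- two in opposite directions between `z` and `x`, although they differ by at most one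
      -- everywhere.
      rcases hG.closer_or_closer s hyz with h | h
      · exact hG.closer_unique s hxy.symm hyz hs h
      · omega
    subst this
    omega

/-- An orientation of a tree in which all out-degrees are at most one points towards a root. -/
theorem IsTree.exists_root_of_orientation [Finite V] (hG : G.IsTree) (P : V → V → Prop)
    (hor : ∀ x y, G.Adj x y → (P x y ↔ ¬ P y x))
    (hout : ∀ x y z, G.Adj x y → G.Adj x z → P x y → P x z → y = z) :
    ∃ r, ∀ x y, G.Adj x y → (P x y ↔ G.dist r y < G.dist r x) := by
  classical
  have := Fintype.ofFinite V
  -- There is a sink: otherwise choosing an out-edge at each vertex injects the vertices into the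
  -- edges, and a tree has one edge too few.
  obtain ⟨r, hr⟩ : ∃ r, ∀ y, G.Adj r y → ¬ P r y := by
    by_contra! h
    choose f hf1 hf2 using h
    have hinj : Function.Injective fun x => (⟨s(x, f x), hf1 x⟩ : G.edgeSet) := by
      intro x y hxy
      rcases Sym2.eq_iff.1 (congrArg Subtype.val hxy) with h | ⟨h1, h2⟩
      · exact h.1
      · have := hf2 y
        rw [← h1] at this
        have h3 := (hor _ _ (hf1 x)).1 (hf2 x)
        rw [h2] at h3
        exact absurd this h3
    have h1 := Nat.card_le_card_of_injective _ hinj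
    have h2 : Nat.card G.edgeSet + 1 = Nat.card V := (isTree_iff_connected_and_card.1 hG).2
    change Nat.card V ≤ Nat.card G.edgeSet at h1
    omega
  have key : ∀ n x y, G.dist r y = n → G.Adj x y → G.dist r y < G.dist r x → P x y := by
    intro n
    induction n using Nat.strong_induction_on with
    | _ n ih =>
      intro x y hn hxy hlt
      rw [hor x y hxy]
      intro hyx
      by_cases hyr : y = r
      · subst hyr
        exact hr _ hxy.symm hyx
      · obtain ⟨z, hyz, hz⟩ := hG.connected.exists_closer hyr
        have := hout y x z hxy.symm hyz hyx (ih _ (by omega) y z rfl hyz hz)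
        subst this
        omega
  refine ⟨r, fun x y hxy => ⟨fun h => ?_, key _ x y rfl hxy⟩⟩
  by_contra hlt
  have := hG.closer_or_closer r hxy
  exact (hor x y hxy).1 h (key _ y x rfl hxy.symm (by omega))

/-- A connectedness and acyclicity criterion: away from a root, every vertex has a unique neighbour
of smaller height, and adjacent vertices have different heights. -/
theorem isTree_of_height [Finite V] (h : V → ℕ) (ρ : V)
    (hne : ∀ x y, G.Adj x y → h x ≠ h y)
    (hex : ∀ x, x ≠ ρ → ∃ y, G.Adj x y ∧ h y < h x)
    (huniq : ∀ x y z, G.Adj x y → G.Adj x z → h y < h x → h z < h x → y = z)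
    (hρ : ∀ y, G.Adj ρ y → h ρ ≤ h y) : G.IsTree := by
  classical
  have := Fintype.ofFinite V
  have hreach : ∀ n x, h x = n → G.Reachable x ρ := by
    intro n
    induction n using Nat.strong_induction_on with
    | _ n ih =>
      intro x hx
      by_cases hxρ : x = ρ
      · rw [hxρ]
      · obtain ⟨y, hxy, hy⟩ := hex x hxρ
        exact hxy.reachable.trans (ih _ (by omega) y rfl)
  have hconn : G.Connected := (connected_iff _).2
    ⟨fun x y => (hreach _ x rfl).trans (hreach _ y rfl).symm, ⟨ρ⟩⟩
  -- Only an upper bound on the number of edges is left: an edge is determined by its higher end,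
  -- which is never `ρ`.
  refine isTree_iff_connected_and_card.2 ⟨hconn, le_antisymm ?_ hconn.card_vert_le_card_edgeSet_add_one⟩
  choose! p hp1 hp2 using hex
  have hmaps : ∀ e : G.edgeSet, ∃ x : {x // x ≠ ρ}, s(x.1, p x.1) = e.1 := by
    rintro ⟨e, he⟩
    induction e with
    | _ x y =>
      have key : ∀ x y, G.Adj x y → h y < h x → ∃ x' : {x // x ≠ ρ}, s(x'.1, p x'.1) = s(x, y) := by
        intro x y hxy hlt
        have hx : x ≠ ρ := by
          rintro rfl
          exact absurd (hρ y hxy) (by omega)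
        exact ⟨⟨x, hx⟩, by rw [huniq x _ _ (hp1 x hx) hxy (hp2 x hx) hlt]⟩
      rcases lt_or_gt_of_ne (hne x y he) with hlt | hlt
      · obtain ⟨z, hz⟩ := key y x (G.adj_symm he) hlt
        exact ⟨z, hz.trans Sym2.eq_swap⟩
      · exact key x y he hlt
  choose g hg using hmaps
  have hinj : Function.Injective g := fun e f hef => Subtype.ext (by rw [← hg e, ← hg f, hef])
  have h1 := Nat.card_le_card_of_injective g hinj
  have h2 : Nat.card {x // x ≠ ρ} + 1 = Nat.card V := by
    rw [Nat.card_eq_fintype_card, Nat.card_eq_fintype_card, Fintype.card_subtype_compl,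
      Fintype.card_subtype_eq]
    have : 0 < Fintype.card V := Fintype.card_pos_iff.2 ⟨ρ⟩
    omega
  omega

end TreeDistance

/-! ### Token slides when the `γ`-graph is a tree. -/

section Necessity

variable {W : Type*} [DecidableEq W] {T : SimpleGraph W}

/-- `x` is in the closed neighbourhood of `p`. -/
def InClosedNbhd (T : SimpleGraph W) (x p : W) : Prop := x = p ∨ T.Adj x p

/-- `D` dominates the vertex `x`. -/
def Dominates (T : SimpleGraph W) (D : Finset W) (x : W) : Prop := ∃ d ∈ D, T.InClosedNbhd x d

omit [DecidableEq W] in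
theorem InClosedNbhd.symm {x p : W} (h : T.InClosedNbhd x p) : T.InClosedNbhd p x :=
  h.imp Eq.symm Adj.symm

omit [DecidableEq W] in
theorem isDominating_iff {D : Finset W} : T.IsDominating D ↔ ∀ x, T.Dominates D x := by
  constructor
  · intro h x
    by_cases hx : x ∈ D
    · exact ⟨x, hx, Or.inl rfl⟩
    · obtain ⟨u, hu, hxu⟩ := h x hx
      exact ⟨u, hu, Or.inr hxu⟩
  · intro h x hx
    obtain ⟨u, hu, rfl | hxu⟩ := h x
    · exact absurd hu hx
    · exact ⟨u, hu, hxu⟩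

/-- Sliding the token at `u` along the edge `uv` is a move from `D` to another `γ`-set. -/
structure IsMove (T : SimpleGraph W) (D : Finset W) (u v : W) : Prop where
  mem : u ∈ D
  notMem : v ∉ D
  adj : T.Adj u v
  gammaSet : T.IsGammaSet (insert v (D.erase u))

omit [DecidableEq W] in
theorem IsGammaSet.card_eq {D D' : Finset W} (h : T.IsGammaSet D) (h' : T.IsGammaSet D') :
    D.card = D'.card := le_antisymm (h.2 _ h'.1) (h'.2 _ h.1)

omit [DecidableEq W] in
theorem IsGammaSet.of_card_le {D D' : Finset W} (h : T.IsGammaSet D) (h' : T.IsDominating D')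
    (hc : D'.card ≤ D.card) : T.IsGammaSet D' := ⟨h', fun _ hE => hc.trans (h.2 _ hE)⟩

theorem gammaGraph_adj_iff {D D' : {D : Finset W // T.IsGammaSet D}} :
    T.gammaGraph.Adj D D' ↔ ∃ u v, T.IsMove D.1 u v ∧ D'.1 = insert v (D.1.erase u) := by
  constructor
  · rintro ⟨u, hu, v, -, huv, h⟩
    have h' : D'.1 = insert v (D.1.erase u) := by
      rw [h, Finset.union_comm]
      rfl
    refine ⟨u, v, ⟨hu, fun hv => ?_, huv, h' ▸ D'.2⟩, h'⟩
    have hc := D.2.card_eq D'.2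
    rw [h', Finset.insert_eq_of_mem (Finset.mem_erase.2 ⟨huv.ne', hv⟩)] at hc
    exact (Finset.card_erase_lt_of_mem hu).ne' hc
  · rintro ⟨u, v, h, h'⟩
    refine ⟨u, h.mem, v, by simp [h'], h.adj, ?_⟩
    rw [h', Finset.union_comm]
    rfl

/-- If the token at `u` can move to two places, then `u` is its only private neighbour. -/
theorem IsMove.dominates_erase (hT : T.IsTree) {D : Finset W} {u v v' : W} (h : T.IsMove D u v)
    (h' : T.IsMove D u v') (hne : v ≠ v') {x : W} (hx : x ≠ u) : T.Dominates (D.erase u) x := by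
  by_contra hnd
  -- If the tokens at rest miss `x`, both landing places must dominate it; a second common neighbour
  -- of `v` and `v'` or a triangle results.
  have key : ∀ w, T.IsMove D u w → T.InClosedNbhd x w := by
    intro w hw
    obtain ⟨d, hd, hxd⟩ := isDominating_iff.1 hw.gammaSet.1 x
    rcases Finset.mem_insert.1 hd with rfl | hd
    · exact hxd
    · exact absurd ⟨d, hd, hxd⟩ hnd
  have hD : T.Dominates D x := by
    obtain ⟨d, hd, hxd⟩ := isDominating_iff.1 h.gammaSet.1 x
    rcases key v h with rfl | hxv
    · exact ⟨u, h.mem, Or.inr h.adj.symm⟩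
    · rcases key v' h' with rfl | hxv'
      · exact ⟨u, h.mem, Or.inr h'.adj.symm⟩
      · exact absurd (hT.commonNeighbor_unique hne hxv.symm hxv'.symm h.adj.symm h'.adj.symm) hx
  obtain ⟨d, hd, hxd⟩ := hD
  have hdu : d = u := by
    by_contra hdu
    exact hnd ⟨d, Finset.mem_erase.2 ⟨hdu, hd⟩, hxd⟩
  subst hdu
  rcases hxd with rfl | hxd
  · exact hx rfl
  · rcases key v h with rfl | hxv
    · rcases key v' h' with rfl | hxv'
      · exact hne rfl
      · exact hT.not_triangle hxd hxv' h'.adj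
    · exact hT.not_triangle hxd hxv h.adj

/-- If the token at `u` can move to two places, then `u` is dominated only by itself. -/
theorem IsMove.not_dominates_erase (hT : T.IsTree) {D : Finset W} (hD : T.IsGammaSet D)
    {u v v' : W} (h : T.IsMove D u v) (h' : T.IsMove D u v') (hne : v ≠ v') :
    ¬ T.Dominates (D.erase u) u := by
  intro hu
  have : T.IsDominating (D.erase u) := isDominating_iff.2 fun x => by
    by_cases hx : x = u
    · exact hx ▸ hu
    · exact h.dominates_erase hT h' hne hx
  exact (hD.2 _ this).not_gt (Finset.card_erase_lt_of_mem h.mem)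

/-- If the `γ`-graph is a tree, then moves of two different tokens block each other. -/
theorem IsMove.exists_block (hg : T.gammaGraph.IsTree) {D : Finset W}
    (hD : T.IsGammaSet D) {u v u' v' : W} (h : T.IsMove D u v) (h' : T.IsMove D u' v')
    (hne : u ≠ u') : ∃ x, T.Adj u x ∧ T.Adj u' x ∧ ¬ T.Dominates ((D.erase u).erase u') x ∧
      ¬ T.InClosedNbhd x v ∧ ¬ T.InClosedNbhd x v' := by
  have hvu' : v ≠ u' := fun e => h.notMem (e ▸ h'.mem)
  have hv'u : v' ≠ u := fun e => h'.notMem (e ▸ h.mem)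
  -- Otherwise the two slides commute, and `D`, the two single slides and the double slide form a
  -- 4-cycle in the `γ`-graph.
  have hnot : ¬ T.IsDominating (insert v' (insert v ((D.erase u).erase u'))) := by
    intro hdom
    have hc : ((D.erase u).erase u').card + 2 = D.card := by
      have h1 := Finset.card_erase_add_one h.mem
      have h2 := Finset.card_erase_add_one (Finset.mem_erase.2 ⟨hne.symm, h'.mem⟩)
      omega
    have hc1 : (insert v ((D.erase u).erase u')).card ≤ ((D.erase u).erase u').card + 1 :=
      Finset.card_insert_le _ _
    have hvv : v ≠ v' := by
      rintro rfl
      rw [Finset.insert_idem] at hdom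
      have := hD.2 _ hdom
      omega
    have hc2 := Finset.card_insert_le v' (insert v ((D.erase u).erase u'))
    have hgam := hD.of_card_le hdom (by omega)
    have e1 : insert v' (insert v ((D.erase u).erase u')) =
        insert v' ((insert v (D.erase u)).erase u') := by
      rw [Finset.erase_insert_of_ne hvu']
    have e2 : insert v' (insert v ((D.erase u).erase u')) =
        insert v ((insert v' (D.erase u')).erase u) := by
      rw [Finset.erase_insert_of_ne hv'u, Finset.erase_right_comm, Finset.insert_comm]
    have m1 : T.IsMove (insert v (D.erase u)) u' v' :=
      ⟨by simp [hne.symm, h'.mem], by simp [hvv.symm, h'.notMem], h'.adj, e1 ▸ hgam⟩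
    have m2 : T.IsMove (insert v' (D.erase u')) u v :=
      ⟨by simp [hne, h.mem], by simp [hvv, h.notMem], h.adj, e2 ▸ hgam⟩
    have a1 : T.gammaGraph.Adj ⟨D, hD⟩ ⟨_, h.gammaSet⟩ := gammaGraph_adj_iff.2 ⟨u, v, h, rfl⟩
    have a2 : T.gammaGraph.Adj ⟨D, hD⟩ ⟨_, h'.gammaSet⟩ := gammaGraph_adj_iff.2 ⟨u', v', h', rfl⟩
    have a3 : T.gammaGraph.Adj ⟨_, hgam⟩ ⟨_, h.gammaSet⟩ :=
      (gammaGraph_adj_iff.2 ⟨u', v', m1, e1⟩).symm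
    have a4 : T.gammaGraph.Adj ⟨_, hgam⟩ ⟨_, h'.gammaSet⟩ :=
      (gammaGraph_adj_iff.2 ⟨u, v, m2, e2⟩).symm
    have hne1 : (⟨D, hD⟩ : {D : Finset W // T.IsGammaSet D}) ≠ ⟨_, hgam⟩ := by
      intro e
      have hu := h.mem
      rw [show D = _ from congrArg Subtype.val e] at hu
      simp [hv'u.symm, h.adj.ne] at hu
    have e3 := congrArg Subtype.val (hg.commonNeighbor_unique hne1 a1 a3 a2 a4)
    have hv : v ∈ insert v' (D.erase u') := by
      rw [← show insert v (D.erase u) = insert v' (D.erase u') from e3]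
      simp
    simp [hvv, h.notMem] at hv
  rw [isDominating_iff] at hnot
  push Not at hnot
  obtain ⟨x, hx⟩ := hnot
  have hnv : ¬ T.InClosedNbhd x v := fun hxv => hx ⟨v, by simp, hxv⟩
  have hnv' : ¬ T.InClosedNbhd x v' := fun hxv => hx ⟨v', by simp, hxv⟩
  have hnd : ¬ T.Dominates ((D.erase u).erase u') x := fun ⟨d, hd, hxd⟩ =>
    hx ⟨d, Finset.mem_insert_of_mem (Finset.mem_insert_of_mem hd), hxd⟩
  have hu' : T.Adj u' x := by
    obtain ⟨d, hd, hxd⟩ := isDominating_iff.1 h.gammaSet.1 x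
    rcases Finset.mem_insert.1 hd with rfl | hd
    · exact absurd hxd hnv
    · by_cases hdu : d = u'
      · subst hdu
        rcases hxd with rfl | hxd
        · exact absurd (Or.inr h'.adj) hnv'
        · exact hxd.symm
      · exact absurd ⟨d, Finset.mem_erase.2 ⟨hdu, hd⟩, hxd⟩ hnd
  have hu : T.Adj u x := by
    obtain ⟨d, hd, hxd⟩ := isDominating_iff.1 h'.gammaSet.1 x
    rcases Finset.mem_insert.1 hd with rfl | hd
    · exact absurd hxd hnv'
    · by_cases hdu : d = u
      · subst hdu
        rcases hxd with rfl | hxd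
        · exact absurd (Or.inr h.adj) hnv
        · exact hxd.symm
      · rw [Finset.erase_right_comm] at hnd
        exact absurd ⟨d, Finset.mem_erase.2 ⟨hdu, hd⟩, hxd⟩ hnd
  exact ⟨x, hu, hu', hnd, hnv, hnv'⟩

/-- If the `γ`-graph is a tree, a token that can move to two places is the only one that can
move. -/
theorem IsMove.eq_of_two (hT : T.IsTree) (hg : T.gammaGraph.IsTree) {D : Finset W}
    (hD : T.IsGammaSet D) {u v w u' v' : W} (h : T.IsMove D u v) (hw : T.IsMove D u w)
    (hvw : v ≠ w) (h' : T.IsMove D u' v') : u = u' := by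
  by_contra hne
  obtain ⟨x, hux, hu'x, hnd, hnv, hnv'⟩ := h.exists_block hg hD h' hne
  have hxD : x ∉ D := fun hx => hnd ⟨x, by simp [hux.ne', hu'x.ne', hx], Or.inl rfl⟩
  -- The token at `u` is needed only for `u` itself, so it may also slide to the blocking vertex
  -- `x`.
  have hdom : T.IsDominating (insert x (D.erase u)) := isDominating_iff.2 fun y => by
    by_cases hy : y = u
    · exact ⟨x, by simp, Or.inr (hy ▸ hux)⟩
    · obtain ⟨d, hd, hyd⟩ := h.dominates_erase hT hw hvw hy
      exact ⟨d, Finset.mem_insert_of_mem hd, hyd⟩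
  have hx : T.IsMove D u x := by
    refine ⟨h.mem, hxD, hux, hD.of_card_le hdom ?_⟩
    have h1 := Finset.card_erase_add_one h.mem
    have h2 := Finset.card_insert_le x (D.erase u)
    omega
  -- The slide to `x` must be blocked in turn, by a common neighbour of `u` and `u'` that `x` does
  -- not dominate; but `x` is their only common neighbour.
  obtain ⟨y, huy, hu'y, -, hny, -⟩ := hx.exists_block hg hD h' hne
  exact hny (Or.inl (hT.commonNeighbor_unique hne huy hu'y hux hu'x))

/-- If the `γ`-graph is a tree, then no three different tokens can move. -/
theorem IsMove.not_three (hT : T.IsTree) (hg : T.gammaGraph.IsTree) {D : Finset W}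
    (hD : T.IsGammaSet D) {a b c a' b' c' : W} (ha : T.IsMove D a a') (hb : T.IsMove D b b')
    (hc : T.IsMove D c c') (hab : a ≠ b) (hac : a ≠ c) (hbc : b ≠ c) : False := by
  obtain ⟨x, hax, hbx, hx, -⟩ := ha.exists_block hg hD hb hab
  obtain ⟨y, hby, hcy, -⟩ := hb.exists_block hg hD hc hbc
  obtain ⟨z, haz, hcz, -⟩ := ha.exists_block hg hD hc hac
  -- The three pairwise blocking vertices close a hexagon; they do not coincide, because the one for
  -- `a` and `b` is not dominated by `c`.
  refine hT.not_hexagon hab hac hbc hax hbx hby hcy hcz haz ?_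
  rintro rfl
  exact hx ⟨c, by simp [hac.symm, hbc.symm, hc.mem], Or.inr hcy.symm⟩

/-- At a vertex with three neighbours, a token that can move can move to two places. -/
theorem IsMove.exists_second (hT : T.IsTree) (hg : T.gammaGraph.IsTree)
    {D D₁ D₂ D₃ : {D : Finset W // T.IsGammaSet D}}
    (h₂ : T.gammaGraph.Adj D D₂) (h₃ : T.gammaGraph.Adj D D₃) (h12 : D₁ ≠ D₂) (h13 : D₁ ≠ D₃)
    (h23 : D₂ ≠ D₃) {u v : W} (h : T.IsMove D.1 u v) (hD₁ : D₁.1 = insert v (D.1.erase u)) :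
    ∃ w, T.IsMove D.1 u w ∧ v ≠ w := by
  obtain ⟨u₂, v₂, m₂, e₂⟩ := gammaGraph_adj_iff.1 h₂
  obtain ⟨u₃, v₃, m₃, e₃⟩ := gammaGraph_adj_iff.1 h₃
  by_cases h2 : u = u₂
  · subst h2
    refine ⟨v₂, m₂, ?_⟩
    rintro rfl
    exact h12 (Subtype.ext (hD₁.trans e₂.symm))
  by_cases h3 : u = u₃
  · subst h3
    refine ⟨v₃, m₃, ?_⟩
    rintro rfl
    exact h13 (Subtype.ext (hD₁.trans e₃.symm))
  by_cases h4 : u₂ = u₃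
  · subst h4
    have : v₂ ≠ v₃ := by
      rintro rfl
      exact h23 (Subtype.ext (e₂.trans e₃.symm))
    exact absurd (m₂.eq_of_two hT hg D.2 m₃ this h).symm h2
  · exact (h.not_three hT hg D.2 m₂ m₃ h2 h3 h4).elim

/-- If the `γ`-graph of a tree is a tree, no two of its adjacent vertices have three neighbours
each. -/
theorem gammaGraph_not_adj_of_three (hT : T.IsTree) (hg : T.gammaGraph.IsTree)
    {D E D₂ D₃ E₂ E₃ : {D : Finset W // T.IsGammaSet D}} (h : T.gammaGraph.Adj D E)
    (hD₂ : T.gammaGraph.Adj D D₂) (hD₃ : T.gammaGraph.Adj D D₃) (hED₂ : E ≠ D₂) (hED₃ : E ≠ D₃)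
    (hD : D₂ ≠ D₃) (hE₂ : T.gammaGraph.Adj E E₂) (hE₃ : T.gammaGraph.Adj E E₃) (hDE₂ : D ≠ E₂)
    (hDE₃ : D ≠ E₃) (hE : E₂ ≠ E₃) : False := by
  obtain ⟨u, v, m, e⟩ := gammaGraph_adj_iff.1 h
  have e' : D.1 = insert u (E.1.erase v) := by
    rw [e, Finset.erase_insert (by simp [m.notMem]), Finset.insert_erase m.mem]
  have m' : T.IsMove E.1 v u := by
    refine ⟨by simp [e], ?_, m.adj.symm, e' ▸ D.2⟩
    rw [e]
    simp [m.adj.ne]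
  obtain ⟨w, mw, hvw⟩ := IsMove.exists_second hT hg hD₂ hD₃ hED₂ hED₃ hD m e
  obtain ⟨w', mw', huw'⟩ := IsMove.exists_second hT hg hE₂ hE₃ hDE₂ hDE₃ hE m' e'
  have h1 := m'.dominates_erase hT mw' huw' (x := u) m.adj.ne
  -- The same tokens stay at rest, whichever end the slide is viewed from.
  have h2 : E.1.erase v = D.1.erase u := by
    rw [e, Finset.erase_insert (by simp [m.notMem])]
  exact m.not_dominates_erase hT D.2 mw hvw (h2 ▸ h1)

end Necessity

/-! ### Packings as certificates of minimality. -/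

section Packing

variable {W : Type*} {T : SimpleGraph W}

/-- The closed neighbourhoods of the vertices in `P` are pairwise disjoint. -/
def IsPacking (T : SimpleGraph W) (P : Finset W) : Prop :=
  ∀ ⦃p⦄, p ∈ P → ∀ ⦃p'⦄, p' ∈ P → ∀ ⦃w⦄, T.InClosedNbhd w p → T.InClosedNbhd w p' → p = p'

/-- `D` meets each closed neighbourhood of the vertices in `P` at most once, and lies in their
union. -/
structure IsTight (T : SimpleGraph W) (P D : Finset W) : Prop where
  cover : ∀ d ∈ D, ∃ p ∈ P, T.InClosedNbhd d p
  unique : ∀ p ∈ P, ∀ d ∈ D, ∀ d' ∈ D, T.InClosedNbhd d p → T.InClosedNbhd d' p → d = d'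

theorem IsPacking.card_le {P D : Finset W} (hP : T.IsPacking P) (hD : T.IsDominating D) :
    P.card ≤ D.card :=
  Finset.card_le_card_of_forall_subsingleton (fun p d => T.InClosedNbhd d p)
    (fun p _ => by
      obtain ⟨d, hd, h⟩ := isDominating_iff.1 hD p
      exact ⟨d, hd, h.symm⟩)
    (fun _ _ _ hp _ hq => hP hp.1 hq.1 hp.2 hq.2)

theorem IsTight.card_le {P D : Finset W} (h : T.IsTight P D) : D.card ≤ P.card :=
  Finset.card_le_card_of_forall_subsingleton (fun d p => T.InClosedNbhd d p)
    h.cover (fun p hp _ hd _ hd' => h.unique p hp _ hd.1 _ hd'.1 hd.2 hd'.2)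

/-- Choosing a dominating token for each center is injective, because closed neighbourhoods of
centers are disjoint. By the count it is bijective, so every token is the one chosen for some
center. -/
theorem IsPacking.isTight {P D : Finset W} (hP : T.IsPacking P) (hD : T.IsDominating D)
    (hc : D.card ≤ P.card) : T.IsTight P D := by
  have h : ∀ p : P, ∃ d : D, T.InClosedNbhd d.1 p.1 := fun p => by
    obtain ⟨d, hd, h⟩ := isDominating_iff.1 hD p
    exact ⟨⟨d, hd⟩, h.symm⟩
  choose f hf using h
  have hinj : Function.Injective f := fun p q hpq => by
    have hq := hf q
    rw [← hpq] at hq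
    exact Subtype.ext (hP p.2 q.2 (hf p) hq)
  have hbij : Function.Bijective f :=
    (Fintype.bijective_iff_injective_and_card f).2
      ⟨hinj, by simpa using le_antisymm (hP.card_le hD) hc⟩
  refine ⟨fun d hd => ?_, fun p hp d hd d' hd' h h' => ?_⟩
  · obtain ⟨p, hp⟩ := hbij.2 ⟨d, hd⟩
    have := hf p
    rw [hp] at this
    exact ⟨p, p.2, this⟩
  · obtain ⟨q, hq⟩ := hbij.2 ⟨d, hd⟩
    obtain ⟨q', hq'⟩ := hbij.2 ⟨d', hd'⟩
    have h1 := hf q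
    have h2 := hf q'
    rw [hq] at h1
    rw [hq'] at h2
    have : q = q' := Subtype.ext ((hP q.2 hp h1 h).trans (hP q'.2 hp h2 h').symm)
    rw [← this, hq] at hq'
    exact congrArg Subtype.val hq'

/-- Given one tight dominating set, the `γ`-sets are exactly the tight dominating sets. -/
theorem IsPacking.isGammaSet_iff {P D₀ : Finset W} (hP : T.IsPacking P) (hD₀ : T.IsDominating D₀)
    (ht : T.IsTight P D₀) (D : Finset W) :
    T.IsGammaSet D ↔ T.IsDominating D ∧ T.IsTight P D :=
  ⟨fun h => ⟨h.1, hP.isTight h.1 ((h.2 _ hD₀).trans ht.card_le)⟩,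
    fun h => ⟨h.1, fun _ hE => h.2.card_le.trans (hP.card_le hE)⟩⟩

end Packing

/-! ### The gadget and why it is a tree. -/

section Gadget

variable {V : Type*}

/-- The vertices of the subdivision of `G`: the vertices of `G` and, for each edge `xv` with `v`
outside `B`, a vertex on that edge next to `v`. -/
inductive SubdivVert (G : SimpleGraph V) (B : V → Prop) : Type _
  | vert (x : V)
  | dart (x v : V) (h : G.Adj x v ∧ ¬ B v)

/-- The vertices that need not be dominated from within the subdivision. -/
def SubdivVert.IsFree {G : SimpleGraph V} {B : V → Prop} : SubdivVert G B → Prop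
  | vert x => ¬ B x ∧ ∀ y z, G.Adj x y → G.Adj x z → y = z
  | dart x _ _ => B x

/-- The subdivision together with pendant stars with two leaves at the free vertices. -/
inductive GadgetVert (G : SimpleGraph V) (B : V → Prop) : Type _
  | base (s : SubdivVert G B)
  | hub (s : SubdivVert G B) (h : s.IsFree)
  | leaf (s : SubdivVert G B) (h : s.IsFree) (i : Bool)

open SubdivVert GadgetVert

variable {G : SimpleGraph V} {B : V → Prop}

/-- Each edge of the gadget in one of its directions. -/
inductive GadgetRel (G : SimpleGraph V) (B : V → Prop) : GadgetVert G B → GadgetVert G B → Prop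
  | near (x v h) : GadgetRel G B (base (vert v)) (base (dart x v h))
  | far (x v h) (hx : B x) : GadgetRel G B (base (vert x)) (base (dart x v h))
  | mid (x v h h') : GadgetRel G B (base (dart x v h)) (base (dart v x h'))
  | hub (s h) : GadgetRel G B (base s) (hub s h)
  | leaf (s h i) : GadgetRel G B (hub s h) (leaf s h i)

/-- The tree whose `γ`-graph is `G`. -/
def gadget (G : SimpleGraph V) (B : V → Prop) : SimpleGraph (GadgetVert G B) :=
  fromRel (GadgetRel G B)

theorem GadgetRel.ne {a b : GadgetVert G B} (h : GadgetRel G B a b) : a ≠ b := by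
  cases h with
  | mid x v h h' =>
    intro e
    simp only [base.injEq, dart.injEq] at e
    exact h.1.ne e.1
  | _ => simp

theorem gadget_adj {a b : GadgetVert G B} :
    (gadget G B).Adj a b ↔ GadgetRel G B a b ∨ GadgetRel G B b a := by
  rw [gadget, fromRel_adj]
  exact ⟨fun h => h.2, fun h => ⟨h.elim GadgetRel.ne fun h => h.ne.symm, h⟩⟩

instance [Finite V] : Finite (SubdivVert G B) :=
  Finite.of_injective (β := V ⊕ V × V)
    (fun s => match s with
      | vert x => Sum.inl x
      | dart x v _ => Sum.inr (x, v)) <| by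
    rintro (_ | _) (_ | _) h <;> simp_all

instance [Finite V] : Finite (GadgetVert G B) :=
  Finite.of_injective (β := SubdivVert G B ⊕ SubdivVert G B ⊕ SubdivVert G B × Bool)
    (fun s => match s with
      | base s => Sum.inl s
      | GadgetVert.hub s _ => Sum.inr (Sum.inl s)
      | GadgetVert.leaf s _ i => Sum.inr (Sum.inr (s, i))) <| by
    rintro (_ | _ | _) (_ | _ | _) h <;> simp_all

@[simp] theorem gadget_adj_vert_vert (x y : V) :
    ¬ (gadget G B).Adj (base (vert x)) (base (vert y)) := by
  rw [gadget_adj]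
  rintro (h | h) <;> cases h

@[simp] theorem gadget_adj_vert_dart (y x v : V) (h) :
    (gadget G B).Adj (base (vert y)) (base (dart x v h)) ↔ y = v ∨ y = x ∧ B x := by
  rw [gadget_adj]
  constructor
  · rintro (h | h) <;> cases h <;> simp_all
  · rintro (rfl | ⟨rfl, hB⟩)
    · exact Or.inl (.near ..)
    · exact Or.inl (.far _ _ _ hB)

@[simp] theorem gadget_adj_dart_dart (y w x v : V) (h h') :
    (gadget G B).Adj (base (dart y w h')) (base (dart x v h)) ↔ y = v ∧ w = x := by
  rw [gadget_adj]
  constructor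
  · rintro (h | h) <;> cases h <;> simp_all
  · rintro ⟨rfl, rfl⟩
    exact Or.inl (.mid ..)

@[simp] theorem gadget_adj_base_hub (s t : SubdivVert G B) (h) :
    (gadget G B).Adj (base s) (hub t h) ↔ s = t := by
  rw [gadget_adj]
  constructor
  · rintro (h | h) <;> cases h
    rfl
  · rintro rfl
    exact Or.inl (.hub ..)

@[simp] theorem gadget_adj_base_leaf (s t : SubdivVert G B) (h i) :
    ¬ (gadget G B).Adj (base s) (leaf t h i) := by
  rw [gadget_adj]
  rintro (h | h) <;> cases h

@[simp] theorem gadget_adj_hub_hub (s t : SubdivVert G B) (h h') :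
    ¬ (gadget G B).Adj (hub s h) (hub t h') := by
  rw [gadget_adj]
  rintro (h | h) <;> cases h

@[simp] theorem gadget_adj_hub_leaf (s t : SubdivVert G B) (h h' i) :
    (gadget G B).Adj (hub s h) (leaf t h' i) ↔ s = t := by
  rw [gadget_adj]
  constructor
  · rintro (h | h) <;> cases h
    rfl
  · rintro rfl
    exact Or.inl (.leaf ..)

@[simp] theorem gadget_adj_leaf_leaf (s t : SubdivVert G B) (h h' i j) :
    ¬ (gadget G B).Adj (leaf s h i) (leaf t h' j) := by
  rw [gadget_adj]
  rintro (h | h) <;> cases h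

@[simp] theorem gadget_adj_dart_vert (y x v : V) (h) :
    (gadget G B).Adj (base (dart x v h)) (base (vert y)) ↔ y = v ∨ y = x ∧ B x := by
  rw [adj_comm, gadget_adj_vert_dart]

@[simp] theorem gadget_adj_hub_base (s t : SubdivVert G B) (h) :
    (gadget G B).Adj (hub t h) (base s) ↔ s = t := by
  rw [adj_comm, gadget_adj_base_hub]

@[simp] theorem gadget_adj_leaf_base (s t : SubdivVert G B) (h i) :
    ¬ (gadget G B).Adj (leaf t h i) (base s) := by
  rw [adj_comm]
  exact gadget_adj_base_leaf s t h i

@[simp] theorem gadget_adj_leaf_hub (s t : SubdivVert G B) (h h' i) :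
    (gadget G B).Adj (leaf t h' i) (hub s h) ↔ s = t := by
  rw [adj_comm, gadget_adj_hub_leaf]

/-- Depth in the subdivision, with respect to a root `ρ` of `G`. -/
noncomputable def SubdivVert.height (ρ : V) : SubdivVert G B → ℕ
  | vert x => 3 * G.dist ρ x
  | dart x v _ => if G.dist ρ v < G.dist ρ x then 3 * G.dist ρ v + 1 else 3 * G.dist ρ x + 2

/-- Depth in the gadget, with respect to a root `ρ` of `G`. -/
noncomputable def GadgetVert.height (ρ : V) : GadgetVert G B → ℕ
  | base s => s.height ρ
  | GadgetVert.hub s _ => s.height ρ + 1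
  | GadgetVert.leaf s _ _ => s.height ρ + 2

/-- Down an edge of `G` the heights run through `3k`, `3k + 1`, `3k + 2`, `3k + 3`, skipping the
value of the missing dart at an end in `B`; independence of `B` ensures that at most one is missing.
-/
theorem gadget_isTree [Finite V] (hG : G.IsTree) (hB : ∀ x y, G.Adj x y → B x → ¬ B y) :
    (gadget G B).IsTree := by
  obtain ⟨ρ⟩ := hG.connected.nonempty
  have hcl := fun {x y} => hG.dist_eq_dist_add_one_of_adj ρ (v := x) (w := y)
  refine isTree_of_height (GadgetVert.height ρ) (base (vert ρ)) ?_ ?_ ?_ ?_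
  · have key : ∀ a b, GadgetRel G B a b → a.height ρ ≠ b.height ρ := by
      intro a b h
      cases h with
      | near x v h =>
        have := hcl h.1
        simp only [GadgetVert.height, SubdivVert.height]
        split_ifs <;> omega
      | far x v h =>
        have := hcl h.1
        simp only [GadgetVert.height, SubdivVert.height]
        split_ifs <;> omega
      | mid x v h =>
        have := hcl h.1
        simp only [GadgetVert.height, SubdivVert.height]
        split_ifs <;> omega
      | hub s h => simp [GadgetVert.height]
      | leaf s h => simp [GadgetVert.height]
    intro a b h
    rcases gadget_adj.1 h with h | h
    · exact key _ _ h
    · exact (key _ _ h).symm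
  · rintro ((x | ⟨x, v, h⟩) | ⟨s, h⟩ | ⟨s, h, i⟩) hne
    · obtain ⟨y, hxy, hy⟩ := hG.connected.exists_closer (r := ρ) (x := x) (by simpa using hne)
      by_cases hBx : B x
      · refine ⟨base (dart x y ⟨hxy, hB x y hxy hBx⟩), by simp [hBx], ?_⟩
        simp only [GadgetVert.height, SubdivVert.height]
        split_ifs; omega
      · refine ⟨base (dart y x ⟨hxy.symm, hBx⟩), by simp, ?_⟩
        simp only [GadgetVert.height, SubdivVert.height]
        split_ifs <;> omega
    · have hd := hcl h.1
      by_cases hlt : G.dist ρ v < G.dist ρ x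
      · exact ⟨base (vert v), by simp, by simp [GadgetVert.height, SubdivVert.height, hlt]⟩
      · by_cases hBx : B x
        · exact ⟨base (vert x), by simp [hBx], by simp [GadgetVert.height, SubdivVert.height, hlt]⟩
        · refine ⟨base (dart v x ⟨h.1.symm, hBx⟩), by simp, ?_⟩
          simp only [GadgetVert.height, SubdivVert.height]
          split_ifs <;> omega
    · exact ⟨base s, by simp, by simp [GadgetVert.height]⟩
    · exact ⟨hub s h, by simp, by simp [GadgetVert.height]⟩
  · rintro ((x | ⟨x, v, h⟩) | ⟨s, h⟩ | ⟨s, h, i⟩) ((y | ⟨y, w, h2⟩) | ⟨t, h2⟩ | ⟨t, h2, i2⟩)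
      ((z | ⟨z, u, h3⟩) | ⟨r, h3⟩ | ⟨r, h3, i3⟩) h4 h5 h6 h7 <;>
      simp only [gadget_adj_vert_vert, gadget_adj_vert_dart, gadget_adj_dart_dart,
        gadget_adj_base_hub, gadget_adj_base_leaf, gadget_adj_hub_hub, gadget_adj_hub_leaf,
        gadget_adj_leaf_leaf, gadget_adj_dart_vert, gadget_adj_hub_base, gadget_adj_leaf_base,
        gadget_adj_leaf_hub, GadgetVert.height] at h4 h5 h6 h7
    all_goals try first | (subst h4; omega) | (subst h5; omega) | (subst h4 h5; rfl)
    -- A lower neighbour of a vertex `x` of `G` lies on the edge from `x` to its parent `p`: next to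
    -- `x` if `x` is outside `B`, and next to `p` otherwise.
    · have key : ∀ y w (h : G.Adj y w ∧ ¬ B w), x = w ∨ x = y ∧ B y →
          SubdivVert.height ρ (dart y w h) < SubdivVert.height ρ (vert x : SubdivVert G B) →
          ∃ p, G.Adj x p ∧ G.dist ρ p < G.dist ρ x ∧
            (¬ B x ∧ y = p ∧ w = x ∨ B x ∧ y = x ∧ w = p) := by
        intro y w h hx hlt
        have := hcl h.1
        simp only [SubdivVert.height] at hlt
        rcases hx with rfl | ⟨rfl, hBx⟩
        · exact ⟨y, h.1.symm, by split_ifs at hlt <;> omega, Or.inl ⟨h.2, rfl, rfl⟩⟩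
        · exact ⟨w, h.1, by split_ifs at hlt <;> omega, Or.inr ⟨hBx, rfl, rfl⟩⟩
      obtain ⟨p, hp1, hp2, hp3⟩ := key y w h2 h4 h6
      obtain ⟨q, hq1, hq2, hq3⟩ := key z u h3 h5 h7
      have hpq := hG.closer_unique ρ hp1 hq1 hp2 hq2
      subst hpq
      rcases hp3 with ⟨_, rfl, rfl⟩ | ⟨_, rfl, rfl⟩ <;>
        rcases hq3 with ⟨_, rfl, rfl⟩ | ⟨_, rfl, rfl⟩ <;> first | rfl | contradiction
    · have := hcl h.1
      simp only [SubdivVert.height] at h6 h7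
      rcases h4 with rfl | ⟨rfl, _⟩ <;> rcases h5 with rfl | ⟨rfl, _⟩ <;>
        first | rfl | (exfalso; split_ifs at h6 h7 <;> omega)
    · obtain ⟨rfl, rfl⟩ := h5
      have := hcl h.1
      simp only [SubdivVert.height] at h6 h7
      rcases h4 with rfl | ⟨rfl, hBx⟩
      · exfalso
        split_ifs at h6 h7 <;> omega
      · exact absurd hBx h3.2
    · obtain ⟨rfl, rfl⟩ := h4
      have := hcl h.1
      simp only [SubdivVert.height] at h6 h7
      rcases h5 with rfl | ⟨rfl, hBx⟩
      · exfalso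
        split_ifs at h6 h7 <;> omega
      · exact absurd hBx h2.2
    · obtain ⟨rfl, rfl⟩ := h4
      obtain ⟨rfl, rfl⟩ := h5
      rfl
    all_goals rw [h4, h5]
  · rintro y -
    simp [GadgetVert.height, SubdivVert.height]

end Gadget

/-! ### The `γ`-sets of the gadget. -/

section GadgetGammaSets

variable {V : Type*} {G : SimpleGraph V} {B : V → Prop}

open SubdivVert GadgetVert

/-- The vertices of the `γ`-set of the gadget that corresponds to the vertex `r` of `G`. -/
def GadgetVert.IsToken (r : V) : GadgetVert G B → Prop
  | base (vert x) => B x ∧ x = r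
  | base (dart x v _) => G.dist r v < G.dist r x
  | GadgetVert.hub _ _ => True
  | GadgetVert.leaf _ _ _ => False

/-- Vertices of the gadget with disjoint closed neighbourhoods, for a root `ρ` of `G`. -/
def GadgetVert.IsCenter (ρ : V) : GadgetVert G B → Prop
  | base (vert x) => B x
  | base (dart x v _) => ¬ B x ∧ G.dist ρ x < G.dist ρ v
  | GadgetVert.hub _ _ => False
  | GadgetVert.leaf _ _ i => i = false

section

variable [Finite V]

/-- The `γ`-set of the gadget that corresponds to the vertex `r` of `G`. -/
noncomputable def tokenSet (G : SimpleGraph V) (B : V → Prop) (r : V) :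
    Finset (GadgetVert G B) := (Set.toFinite {w | w.IsToken r}).toFinset

/-- A largest packing of the gadget. -/
noncomputable def centerSet (G : SimpleGraph V) (B : V → Prop) (ρ : V) :
    Finset (GadgetVert G B) := (Set.toFinite {w | w.IsCenter ρ}).toFinset

theorem mem_tokenSet {r : V} {w : GadgetVert G B} : w ∈ tokenSet G B r ↔ w.IsToken r := by
  simp [tokenSet]

theorem mem_centerSet {ρ : V} {w : GadgetVert G B} : w ∈ centerSet G B ρ ↔ w.IsCenter ρ := by
  simp [centerSet]

/-- On an edge without end in `B` the center is the dart farther from `ρ`. Hence a vertex of `G`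
outside `B` is met only from the edge to its parent, which is unique. Base vertices carrying a hub
are not centers, so each hub is met only by its own leaf. -/
theorem centerSet_isPacking (hG : G.IsTree) (ρ : V) :
    (gadget G B).IsPacking (centerSet G B ρ) := by
  intro p hp q hq w hwp hwq
  rw [mem_centerSet] at hp hq
  have hcu := fun {x y z} => hG.closer_unique ρ (x := x) (y := y) (z := z)
  have hsym := fun {x y} => G.adj_comm x y
  rcases p with ((x | ⟨x, v, h1⟩) | ⟨s, h1⟩ | ⟨s, h1, i⟩) <;>
    rcases q with ((y | ⟨y, u, h2⟩) | ⟨t, h2⟩ | ⟨t, h2, j⟩) <;>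
    rcases w with ((z | ⟨z, a, h3⟩) | ⟨r, h3⟩ | ⟨r, h3, k⟩) <;>
    simp [InClosedNbhd, IsCenter] at hp hq hwp hwq ⊢ <;>
    grind [SubdivVert.IsFree]

/-- A vertex outside `B` that is not free has two neighbours in `G`. At most one is closer to `r`,
and the edge from another one has its token next to the vertex. -/
theorem tokenSet_isDominating (hG : G.IsTree) (hB : ∀ x y, G.Adj x y → B x → ¬ B y) (r : V) :
    (gadget G B).IsDominating (tokenSet G B r) := by
  rw [isDominating_iff]
  rintro ((x | ⟨x, v, h⟩) | ⟨s, h⟩ | ⟨s, h, i⟩)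
  · by_cases hBx : B x
    · by_cases hxr : x = r
      · exact ⟨base (vert x), mem_tokenSet.2 ⟨hBx, hxr⟩, Or.inl rfl⟩
      · obtain ⟨y, hxy, hy⟩ := hG.connected.exists_closer hxr
        exact ⟨base (dart x y ⟨hxy, hB x y hxy hBx⟩), mem_tokenSet.2 hy, Or.inr (by simp [hBx])⟩
    · by_cases hf : (vert x : SubdivVert G B).IsFree
      · exact ⟨hub _ hf, mem_tokenSet.2 trivial, Or.inr (by simp)⟩
      · have hf' : ∃ y z, G.Adj x y ∧ G.Adj x z ∧ y ≠ z := by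
          by_contra! hne
          exact hf ⟨hBx, hne⟩
        obtain ⟨y, z, hxy, hxz, hyz⟩ := hf'
        have key : ∀ y, G.Adj x y → G.dist r x < G.dist r y →
            (gadget G B).Dominates (tokenSet G B r) (base (vert x)) := fun y hxy hlt =>
          ⟨base (dart y x ⟨hxy.symm, hBx⟩), mem_tokenSet.2 hlt, Or.inr (by simp)⟩
        rcases hG.closer_or_closer r hxy with h1 | h1
        · rcases hG.closer_or_closer r hxz with h2 | h2
          · exact absurd (hG.closer_unique r hxy hxz h1 h2) hyz
          · exact key z hxz h2
        · exact key y hxy h1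
  · by_cases hBx : B x
    · have hf : (dart x v h : SubdivVert G B).IsFree := hBx
      exact ⟨hub _ hf, mem_tokenSet.2 trivial, Or.inr (by simp)⟩
    · rcases hG.closer_or_closer r h.1 with h1 | h1
      · exact ⟨base (dart x v h), mem_tokenSet.2 h1, Or.inl rfl⟩
      · exact ⟨base (dart v x ⟨h.1.symm, hBx⟩), mem_tokenSet.2 h1, Or.inr (by simp)⟩
  · exact ⟨hub s h, mem_tokenSet.2 trivial, Or.inl rfl⟩
  · exact ⟨hub s h, mem_tokenSet.2 trivial, Or.inr (by simp)⟩

/-- At most one edge leaves a vertex towards `r`, so a center in `B` sees one token; on an edge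
without end in `B` only one of the two darts is next to the head. -/
theorem tokenSet_isTight (hG : G.IsTree) (ρ r : V) :
    (gadget G B).IsTight (centerSet G B ρ) (tokenSet G B r) := by
  constructor
  · intro d hd
    rw [mem_tokenSet] at hd
    rcases d with ((x | ⟨x, v, h⟩) | ⟨s, h⟩ | ⟨s, h, i⟩)
    · exact ⟨base (vert x), mem_centerSet.2 hd.1, Or.inl rfl⟩
    · by_cases hBx : B x
      · exact ⟨base (vert x), mem_centerSet.2 hBx, Or.inr (by simp [hBx])⟩
      · rcases hG.closer_or_closer ρ h.1 with h1 | h1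
        · exact ⟨base (dart v x ⟨h.1.symm, hBx⟩), mem_centerSet.2 ⟨h.2, h1⟩, Or.inr (by simp)⟩
        · exact ⟨base (dart x v h), mem_centerSet.2 ⟨hBx, h1⟩, Or.inl rfl⟩
    · exact ⟨leaf s h false, mem_centerSet.2 rfl, Or.inr (by simp)⟩
    · exact hd.elim
  · intro p hp d hd d' hd' h h'
    rw [mem_centerSet] at hp
    rw [mem_tokenSet] at hd hd'
    have hcu := fun {x y z} => hG.closer_unique r (x := x) (y := y) (z := z)
    have hsym := fun {x y} => G.adj_comm x y
    rcases p with ((x | ⟨x, v, h1⟩) | ⟨s, h1⟩ | ⟨s, h1, i⟩) <;>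
      rcases d with ((y | ⟨y, u, h2⟩) | ⟨t, h2⟩ | ⟨t, h2, j⟩) <;>
      rcases d' with ((z | ⟨z, a, h3⟩) | ⟨r, h3⟩ | ⟨r, h3, k⟩) <;>
      simp [InClosedNbhd, IsCenter, IsToken] at hp hd hd' h h' ⊢ <;>
      grind [SubdivVert.IsFree]

/-- The `γ`-sets of the gadget are the sets `tokenSet G B r`. -/
theorem eq_tokenSet_of_isTight (hG : G.IsTree) (hB : ∀ x y, G.Adj x y → B x → ¬ B y)
    (hdeg : ∀ x a b c, ¬ B x → G.Adj x a → G.Adj x b → G.Adj x c → a = b ∨ a = c ∨ b = c)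
    (ρ : V) {D : Finset (GadgetVert G B)} (hD : (gadget G B).IsDominating D)
    (ht : (gadget G B).IsTight (centerSet G B ρ) D) : ∃ r, D = tokenSet G B r := by
  rw [isDominating_iff] at hD
  -- The second leaf of a star lies in no closed neighbourhood of a center, so only the hub can
  -- dominate it.
  have hleaf1 : ∀ s h, leaf s h true ∉ D := by
    intro s h hd
    obtain ⟨p, hp, hdp⟩ := ht.cover _ hd
    rw [mem_centerSet] at hp
    rcases p with ((x | ⟨x, v, h1⟩) | ⟨s, h1⟩ | ⟨s, h1, i⟩) <;>
      simp_all [InClosedNbhd, IsCenter]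
  have hhub : ∀ s h, hub s h ∈ D := by
    intro s h
    obtain ⟨d, hd, hds⟩ := hD (leaf s h true)
    rcases d with ((x | ⟨x, v, h1⟩) | ⟨t, h1⟩ | ⟨t, h1, i⟩)
    · simp [InClosedNbhd] at hds
    · simp [InClosedNbhd] at hds
    · simp [InClosedNbhd] at hds
      subst hds
      exact hd
    · simp [InClosedNbhd] at hds
      obtain ⟨rfl, rfl⟩ := hds
      exact absurd hd (hleaf1 _ _)
  have hleaf : ∀ s h i, leaf s h i ∉ D := by
    rintro s h (_ | _)
    · intro hd
      have := ht.unique (leaf s h false) (mem_centerSet.2 rfl) _ hd _ (hhub s h) (Or.inl rfl)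
        (Or.inr (by simp))
      simp at this
    · exact hleaf1 s h
  -- A token on `x` outside `B` would use up the center on the edge to the parent `y` of `x`. The
  -- other dart of that edge then needs a token on `y`, also outside `B`, and this descends towards
  -- `ρ`.
  have hvert : ∀ n x, G.dist ρ x = n → base (vert x) ∈ D → B x := by
    intro n
    induction n using Nat.strong_induction_on with
    | _ n ih =>
      intro x hn hd
      by_contra hBx
      obtain ⟨p, hp, hdp⟩ := ht.cover _ hd
      have hp' := mem_centerSet.1 hp
      rcases p with ((y | ⟨y, v, h1⟩) | ⟨t, h1⟩ | ⟨t, h1, i⟩)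
      · simp [InClosedNbhd] at hdp
        exact hBx (hdp ▸ hp')
      · simp [InClosedNbhd] at hdp
        have hxv : x = v := hdp.resolve_right fun h => hp'.1 h.2
        subst hxv
        obtain ⟨d, hd', hdd⟩ := hD (base (dart x y ⟨h1.1.symm, hp'.1⟩))
        rcases d with ((z | ⟨z, w, h2⟩) | ⟨t, h2⟩ | ⟨t, h2, i⟩)
        · simp [InClosedNbhd, hBx] at hdd
          subst hdd
          exact hp'.1 (ih _ (hn ▸ hp'.2) _ rfl hd')
        · have : base (vert x) = base (dart z w h2) := by
            refine ht.unique _ hp _ hd _ hd' (Or.inr (by simp)) ?_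
            simp [InClosedNbhd] at hdd ⊢
            rcases hdd with ⟨rfl, rfl⟩ | ⟨rfl, rfl⟩ <;> simp
          simp at this
        · simp [InClosedNbhd] at hdd
          subst hdd
          exact hBx h2
        · simp [InClosedNbhd] at hdd
      · exact hp'
      · simp [InClosedNbhd] at hdp
  let M : V → V → Prop := fun x v => ∃ h, base (dart x v h) ∈ D
  -- The center on this edge sees exactly one token, and by `hvert` it is on one of the two darts.
  have hM : ∀ x v, G.Adj x v → ¬ B x → ¬ B v → (M x v ↔ ¬ M v x) := by
    have key : ∀ x v, G.Adj x v → ¬ B x → ¬ B v → G.dist ρ x < G.dist ρ v →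
        (M x v ↔ ¬ M v x) := by
      intro x v hxv hBx hBv hlt
      have hc : base (dart x v ⟨hxv, hBv⟩) ∈ centerSet G B ρ := mem_centerSet.2 ⟨hBx, hlt⟩
      constructor
      · rintro ⟨_, h1⟩ ⟨_, h2⟩
        have := ht.unique _ hc _ h1 _ h2 (Or.inl rfl) (Or.inr (by simp))
        simp only [base.injEq, dart.injEq] at this
        exact hxv.ne this.1
      · intro h
        by_contra h'
        obtain ⟨d, hd, hdd⟩ := hD (base (dart x v ⟨hxv, hBv⟩))
        rcases d with ((z | ⟨z, w, h2⟩) | ⟨t, h2⟩ | ⟨t, h2, i⟩)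
        · simp [InClosedNbhd, hBx] at hdd
          exact hBv (hvert _ _ rfl (hdd ▸ hd))
        · simp [InClosedNbhd] at hdd
          rcases hdd with ⟨rfl, rfl⟩ | ⟨rfl, rfl⟩
          · exact h' ⟨_, hd⟩
          · exact h ⟨_, hd⟩
        · simp [InClosedNbhd] at hdd
          subst hdd
          exact hBx h2
        · simp [InClosedNbhd] at hdd
    intro x v hxv hBx hBv
    rcases hG.closer_or_closer ρ hxv with h | h
    · rw [key v x hxv.symm hBv hBx h, not_not]
    · exact key x v hxv hBx hBv h
  -- On an edge with `y` in `B` only the dart next to the other end exists; its being empty is read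
  -- as pointing to `y`.
  let P : V → V → Prop := fun x y => (¬ B y ∧ M x y) ∨ (B y ∧ ¬ M y x)
  obtain ⟨r, hr⟩ := hG.exists_root_of_orientation P
    (by
      intro x y hxy
      have h1 := hB x y hxy
      have h2 := hM x y hxy
      simp only [P]
      by_cases hx : B x <;> by_cases hy : B y <;> simp_all)
    (by
      intro x y z hxy hxz hPy hPz
      by_cases hBx : B x
      · have hMy : M x y := (hPy.resolve_right fun h => hB x y hxy hBx h.1).2
        have hMz : M x z := (hPz.resolve_right fun h => hB x z hxz hBx h.1).2
        obtain ⟨_, h1⟩ := hMy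
        obtain ⟨_, h2⟩ := hMz
        have := ht.unique (base (vert x)) (mem_centerSet.2 hBx) _ h1 _ h2 (Or.inr (by simp [hBx]))
          (Or.inr (by simp [hBx]))
        simp only [base.injEq, dart.injEq] at this
        exact this.2
      -- Out-edges put no token next to `x`. With two of them, `x` has no hub and must be dominated
      -- along a third edge, against the degree bound outside `B`.
      · have hnot : ∀ y, G.Adj x y → P x y → ¬ M y x := by
          rintro y hxy (h | h)
          · exact (hM x y hxy hBx h.1).1 h.2
          · exact h.2
        have hny := hnot y hxy hPy
        have hnz := hnot z hxz hPz
        obtain ⟨d, hd, hdd⟩ := hD (base (vert x))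
        rcases d with ((u | ⟨u, w, h2⟩) | ⟨t, h2⟩ | ⟨t, h2, i⟩)
        · simp [InClosedNbhd] at hdd
          exact absurd (hvert _ _ rfl (hdd ▸ hd)) hBx
        · simp [InClosedNbhd] at hdd
          have hxw : x = w := hdd.resolve_right fun h => hBx (h.1 ▸ h.2)
          subst hxw
          have hMu : M u x := ⟨h2, hd⟩
          rcases hdeg x y z u hBx hxy hxz h2.1.symm with h | rfl | rfl
          · exact h
          · exact absurd hMu hny
          · exact absurd hMu hnz
        · simp [InClosedNbhd] at hdd
          subst hdd
          exact h2.2 y z hxy hxz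
        · simp [InClosedNbhd] at hdd)
  refine ⟨r, Finset.ext fun w => ?_⟩
  rw [mem_tokenSet]
  have hdart : ∀ x v h, base (dart x v h) ∈ D ↔ G.dist r v < G.dist r x := by
    intro x v h
    rw [← hr x v h.1]
    exact ⟨fun hd => Or.inl ⟨h.2, h, hd⟩, fun hP => (hP.resolve_right fun h' => h.2 h'.1).2.2⟩
  rcases w with ((x | ⟨x, v, h⟩) | ⟨s, h⟩ | ⟨s, h, i⟩)
  · constructor
    · intro hd
      have hBx := hvert _ _ rfl hd
      refine ⟨hBx, ?_⟩
      by_contra hxr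
      obtain ⟨y, hxy, hy⟩ := hG.connected.exists_closer hxr
      have := ht.unique (base (vert x)) (mem_centerSet.2 hBx) _ hd _
        ((hdart x y ⟨hxy, hB x y hxy hBx⟩).2 hy) (Or.inl rfl) (Or.inr (by simp [hBx]))
      simp at this
    · rintro ⟨hBx, rfl⟩
      obtain ⟨d, hd, hdd⟩ := hD (base (vert x))
      rcases d with ((u | ⟨u, w, h2⟩) | ⟨t, h2⟩ | ⟨t, h2, i⟩)
      · simp [InClosedNbhd] at hdd
        exact hdd ▸ hd
      · simp [InClosedNbhd] at hdd
        have hxu : x = u := (hdd.resolve_left fun h => h2.2 (h ▸ hBx)).1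
        subst hxu
        have := (hdart _ _ _).1 hd
        simp at this
      · simp [InClosedNbhd] at hdd
        subst hdd
        exact absurd hBx h2.1
      · simp [InClosedNbhd] at hdd
  · exact hdart x v h
  · exact ⟨fun _ => trivial, fun _ => hhub s h⟩
  · exact ⟨fun hd => hleaf s h i hd, fun hd => hd.elim⟩

theorem isGammaSet_gadget_iff (hG : G.IsTree) (hB : ∀ x y, G.Adj x y → B x → ¬ B y)
    (hdeg : ∀ x a b c, ¬ B x → G.Adj x a → G.Adj x b → G.Adj x c → a = b ∨ a = c ∨ b = c)
    (D : Finset (GadgetVert G B)) :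
    (gadget G B).IsGammaSet D ↔ ∃ r, D = tokenSet G B r := by
  obtain ⟨ρ⟩ := hG.connected.nonempty
  have h := fun r => (centerSet_isPacking hG ρ).isGammaSet_iff (tokenSet_isDominating hG hB r)
    (tokenSet_isTight hG ρ r)
  constructor
  · intro hD
    have := (h ρ D).1 hD
    exact eq_tokenSet_of_isTight hG hB hdeg ρ this.1 this.2
  · rintro ⟨r, rfl⟩
    exact (h r _).2 ⟨tokenSet_isDominating hG hB r, tokenSet_isTight hG ρ r⟩

end

end GadgetGammaSets

/-! ### The `γ`-graph of the gadget. -/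

section GadgetGammaGraph

variable {V : Type*} {G : SimpleGraph V} {B : V → Prop}

open SubdivVert GadgetVert

/-- If the token configurations of `r` and `s` differ by one slide, then `r` and `s` are
adjacent. -/
theorem adj_of_isToken (hG : G.IsTree) {r s : V} {u v : GadgetVert G B} (hu : u.IsToken r)
    (hu' : ¬ u.IsToken s) (hv : v.IsToken s) (hv' : ¬ v.IsToken r)
    (hru : ∀ w : GadgetVert G B, w.IsToken r → ¬ w.IsToken s → w = u)
    (hsv : ∀ w : GadgetVert G B, w.IsToken s → ¬ w.IsToken r → w = v)
    (huv : (gadget G B).Adj u v) : G.Adj r s := by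
  -- An edge oriented differently by `r` and `s` costs a token whenever its head for `r` is outside
  -- `B`, and only one token may be lost.
  have flip : ∀ {r s : V} {u v : GadgetVert G B},
      (∀ w : GadgetVert G B, w.IsToken r → ¬ w.IsToken s → w = u) →
      ∀ x y (h : G.Adj x y ∧ ¬ B y), G.dist r y < G.dist r x → G.dist s x < G.dist s y →
      base (dart x y h) = u := fun h x y hxy h1 h2 => h _ h1 (by simp only [IsToken]; omega)
  -- If the lost token sits on `r`, the path to `s` has length one: its second edge would be
  -- reversed too and lose a dart.
  have star : ∀ {r s y : V} {h : G.Adj r y ∧ ¬ B y}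
      (_ : ∀ w : GadgetVert G B, w.IsToken r → ¬ w.IsToken s → w = base (vert r)),
      G.dist s y < G.dist s r → G.Adj r s := by
    intro r s y h hru hy
    by_cases hys : y = s
    · exact hys ▸ h.1
    · obtain ⟨z, hyz, hz⟩ := hG.connected.exists_closer hys
      have hlt : G.dist r y < G.dist r z := by
        rcases hG.closer_or_closer r hyz with h1 | h1
        · rw [dist_eq_one_iff_adj.2 h.1, Nat.lt_one_iff, hG.connected.dist_eq_zero_iff] at h1
          subst h1
          omega
        · exact h1
      have := flip (v := v) hru z y ⟨hyz.symm, h.2⟩ hlt hz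
      simp at this
  -- If `y` were not `r`, the next edge from `y` towards `r` would be reversed too, giving a second
  -- new token.
  have pair : ∀ {r s x y : V} {h : G.Adj y x ∧ ¬ B x}
      (_ : ∀ w : GadgetVert G B, w.IsToken s → ¬ w.IsToken r → w = base (dart y x h)),
      ¬ B y → G.dist s x < G.dist s y → G.dist r y < G.dist r x → y = r := by
    intro r s x y h hsv hy hlt hlt'
    by_contra hyr
    obtain ⟨z, hyz, hz⟩ := hG.connected.exists_closer hyr
    rcases hG.closer_or_closer s hyz with h1 | h1
    · have hzx := hG.closer_unique s hyz h.1 h1 hlt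
      subst hzx
      omega
    · have := flip (v := v) hsv z y ⟨hyz.symm, hy⟩ h1 hz
      simp only [base.injEq, dart.injEq] at this
      exact hyz.ne this.1.symm
  rcases u with ((x | ⟨x, y, h⟩) | ⟨t, h⟩ | ⟨t, h, i⟩)
  · obtain ⟨hBx, rfl⟩ := hu
    rcases v with ((z | ⟨z, w, h2⟩) | ⟨t, h2⟩ | ⟨t, h2, i⟩)
    · simp at huv
    · simp only [gadget_adj_vert_dart] at huv
      have hxz : x = z := (huv.resolve_left fun h => h2.2 (h ▸ hBx)).1
      subst hxz
      exact star (h := h2) hru hv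
    · exact absurd trivial hv'
    · exact hv.elim
  · rcases v with ((z | ⟨z, w, h2⟩) | ⟨t, h2⟩ | ⟨t, h2, i⟩)
    · obtain ⟨hBz, rfl⟩ := hv
      simp only [gadget_adj_dart_vert] at huv
      have hxz : z = x := (huv.resolve_left fun h' => h.2 (h' ▸ hBz)).1
      subst hxz
      exact (star (h := h) hsv hu).symm
    · simp only [gadget_adj_dart_dart] at huv
      obtain ⟨rfl, rfl⟩ := huv
      have h1 := pair hsv h.2 hv hu
      have h3 := pair hru h2.2 hu hv
      subst h1 h3
      exact h2.1
    · exact absurd trivial hv'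
    · exact hv.elim
  · exact absurd trivial hu'
  · exact hu.elim

/-- If `r` and `s` are adjacent, then their token configurations differ by one slide. -/
theorem exists_slide [Finite V] [DecidableEq (GadgetVert G B)] (hG : G.IsTree) {r s : V}
    (hrs : G.Adj r s) (hs : ¬ B s) : ∃ u ∈ tokenSet G B r, ∃ v ∈ tokenSet G B s,
      (gadget G B).Adj u v ∧ tokenSet G B s = (tokenSet G B r).erase u ∪ {v} := by
  have hd : G.dist s s < G.dist s r := by
    rw [dist_self]
    exact hG.connected.pos_dist_of_ne hrs.ne'
  have hd' : G.dist r r < G.dist r s := by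
    rw [dist_self]
    exact hG.connected.pos_dist_of_ne hrs.ne
  -- Only the edge `rs` changes direction.
  have hclose : ∀ x y, G.Adj x y → ¬ (x = r ∧ y = s) → ¬ (x = s ∧ y = r) →
      (G.dist s y < G.dist s x ↔ G.dist r y < G.dist r x) := by
    intro x y hxy h1 h2
    constructor
    · intro h
      rcases hG.closer_or_closer r hxy with h3 | h3
      · exact h3
      · have := hG.closer_of_adj_root hrs hxy.symm h3 h
        exact absurd this h1
    · intro h
      rcases hG.closer_or_closer s hxy with h3 | h3
      · exact h3
      · have := hG.closer_of_adj_root hrs hxy h h3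
        exact absurd this.symm h2
  by_cases hr : B r
  · refine ⟨base (vert r), mem_tokenSet.2 ⟨hr, rfl⟩, base (dart r s ⟨hrs, hs⟩),
      mem_tokenSet.2 hd, by simp [hr], Finset.ext fun w => ?_⟩
    simp only [Finset.mem_union, Finset.mem_erase, Finset.mem_singleton, mem_tokenSet]
    rcases w with ((x | ⟨x, y, h⟩) | ⟨t, h⟩ | ⟨t, h, i⟩)
    · simp only [IsToken, ne_eq, base.injEq, vert.injEq, reduceCtorEq, or_false]
      grind
    · simp only [IsToken, ne_eq, base.injEq, dart.injEq, reduceCtorEq, not_false_eq_true,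
        true_and]
      have h1 := hclose x y h.1
      have h2 : ¬ (x = s ∧ y = r) := fun h' => h.2 (h'.2 ▸ hr)
      grind
    · simp [IsToken]
    · simp [IsToken]
  · refine ⟨base (dart s r ⟨hrs.symm, hr⟩), mem_tokenSet.2 hd', base (dart r s ⟨hrs, hs⟩),
      mem_tokenSet.2 hd, by simp, Finset.ext fun w => ?_⟩
    simp only [Finset.mem_union, Finset.mem_erase, Finset.mem_singleton, mem_tokenSet]
    rcases w with ((x | ⟨x, y, h⟩) | ⟨t, h⟩ | ⟨t, h, i⟩)
    · simp only [IsToken, ne_eq, base.injEq, reduceCtorEq, or_false]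
      grind
    · simp only [IsToken, ne_eq, base.injEq, dart.injEq]
      have := hclose x y h.1
      grind
    · simp [IsToken]
    · simp [IsToken]

/-- The first edge from `r` towards `s` is oriented differently by the two roots, and at least one
of its darts exists because `B` is independent. -/
theorem tokenSet_injective [Finite V] (hG : G.IsTree) (hB : ∀ x y, G.Adj x y → B x → ¬ B y) :
    Function.Injective (tokenSet G B) := by
  intro r s hrs
  have h : ∀ w : GadgetVert G B, w.IsToken r ↔ w.IsToken s := fun w => by
    rw [← mem_tokenSet, ← mem_tokenSet, hrs]
  by_contra hne
  obtain ⟨x, hrx, hx⟩ := hG.connected.exists_closer hne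
  have h1 := dist_self (G := G) (v := r)
  have h2 := hG.connected.pos_dist_of_ne hrx.ne
  by_cases hBx : B x
  · have := (h (base (dart x r ⟨hrx.symm, hB x r hrx.symm hBx⟩))).1 (by
      simp only [IsToken]
      omega)
    simp only [IsToken] at this
    omega
  · have := (h (base (dart r x ⟨hrx, hBx⟩))).2 hx
    simp only [IsToken] at this
    omega

/-- A finite tree is the `γ`-graph of its gadget. -/
noncomputable def gadgetIso [Finite V] [DecidableEq (GadgetVert G B)] (hG : G.IsTree)
    (hB : ∀ x y, G.Adj x y → B x → ¬ B y)
    (hdeg : ∀ x a b c, ¬ B x → G.Adj x a → G.Adj x b → G.Adj x c → a = b ∨ a = c ∨ b = c) :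
    G ≃g (gadget G B).gammaGraph where
  toEquiv := Equiv.ofBijective
    (fun r => ⟨tokenSet G B r, (isGammaSet_gadget_iff hG hB hdeg _).2 ⟨r, rfl⟩⟩)
    ⟨fun _ _ h => tokenSet_injective hG hB (congrArg Subtype.val h), fun D => by
      obtain ⟨r, hr⟩ := (isGammaSet_gadget_iff hG hB hdeg _).1 D.2
      exact ⟨r, Subtype.ext hr.symm⟩⟩
  map_rel_iff' := by
    intro r s
    change (gadget G B).gammaGraph.Adj ⟨tokenSet G B r, _⟩ ⟨tokenSet G B s, _⟩ ↔ _
    constructor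
    · intro h
      obtain ⟨u, v, m, e⟩ := gammaGraph_adj_iff.1 h
      have hm : ∀ w : GadgetVert G B, w.IsToken s ↔ w = v ∨ w ≠ u ∧ w.IsToken r := fun w => by
        rw [← mem_tokenSet, show tokenSet G B s = _ from e, Finset.mem_insert, Finset.mem_erase,
          mem_tokenSet]
      have hu := mem_tokenSet.1 m.mem
      have hv := fun h => m.notMem (mem_tokenSet.2 h)
      refine adj_of_isToken hG hu ?_ ((hm v).2 (Or.inl rfl)) hv ?_ ?_ m.adj
      · rw [hm]
        rintro (h | h)
        · exact m.adj.ne h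
        · exact h.1 rfl
      · intro w h1 h2
        by_contra h3
        exact h2 ((hm w).2 (Or.inr ⟨h3, h1⟩))
      · intro w h1 h2
        exact ((hm w).1 h1).resolve_right fun h => h2 h.2
    · intro h
      -- A slide is constructed towards an end outside `B`; one of the two ends qualifies.
      by_cases hs : B s
      · exact ((gadget G B).gammaGraph.adj_comm _ _).1
          (exists_slide hG h.symm (hB s r h.symm hs))
      · exact exists_slide hG h hs

end GadgetGammaGraph

/-! ### The choice of `B`, and the forbidden subtree. -/

section Main

variable {V : Type*} {G : SimpleGraph V}

/-- The vertex `x` has at least three neighbours. -/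
def HasThreeNbrs (G : SimpleGraph V) (x : V) : Prop :=
  ∃ a b c, G.Adj x a ∧ G.Adj x b ∧ G.Adj x c ∧ a ≠ b ∧ a ≠ c ∧ b ≠ c

theorem three_le_degree_iff [Fintype V] [DecidableRel G.Adj] {x : V} :
    3 ≤ G.degree x ↔ G.HasThreeNbrs x := by
  rw [← card_neighborFinset_eq_degree, Nat.succ_le_iff, Finset.two_lt_card]
  simp [HasThreeNbrs]

/-- Of three distinct neighbours, two avoid a given vertex. -/
theorem HasThreeNbrs.exists_pair {x : V} (h : G.HasThreeNbrs x) (y : V) :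
    ∃ a b, G.Adj x a ∧ G.Adj x b ∧ a ≠ b ∧ a ≠ y ∧ b ≠ y := by
  obtain ⟨a, b, c, ha, hb, hc, hab, hac, hbc⟩ := h
  by_cases h1 : a = y
  · exact ⟨b, c, hb, hc, hbc, h1 ▸ hab.symm, h1 ▸ hac.symm⟩
  · by_cases h2 : b = y
    · exact ⟨a, c, ha, hc, hac, h1, h2 ▸ hbc.symm⟩
    · exact ⟨a, b, ha, hb, hab, h1, h2⟩

theorem HasThreeNbrs.map_iso {V' : Type*} {G' : SimpleGraph V'} (f : G ≃g G') {x : V}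
    (h : G.HasThreeNbrs x) : G'.HasThreeNbrs (f x) := by
  obtain ⟨a, b, c, ha, hb, hc, hab, hac, hbc⟩ := h
  exact ⟨f a, f b, f c, f.map_adj_iff.2 ha, f.map_adj_iff.2 hb, f.map_adj_iff.2 hc,
    f.injective.ne hab, f.injective.ne hac, f.injective.ne hbc⟩

theorem IsGammaGraphOfTree.of_iso {V' : Type*} {G' : SimpleGraph V'} (f : G ≃g G')
    (h : G'.IsGammaGraphOfTree) : G.IsGammaGraphOfTree := by
  obtain ⟨W, hF, hD, T, hT, ⟨g⟩⟩ := h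
  exact ⟨W, hF, hD, T, hT, ⟨f.trans g⟩⟩

theorem isGammaGraphOfTree_of_not_exists [Finite V] (hG : G.IsTree)
    (h : ¬ ∃ x y, G.Adj x y ∧ G.HasThreeNbrs x ∧ G.HasThreeNbrs y) : G.IsGammaGraphOfTree := by
  classical
  -- The witnessing tree must live in `Type`, so `G` is first copied onto `Fin (Nat.card V)`.
  obtain ⟨G', ⟨f⟩⟩ : ∃ G' : SimpleGraph (Fin (Nat.card V)), Nonempty (G' ≃g G) :=
    ⟨G.comap (Finite.equivFin V).symm, ⟨Iso.comap _ _⟩⟩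
  refine IsGammaGraphOfTree.of_iso f.symm ⟨GadgetVert G' G'.HasThreeNbrs, Fintype.ofFinite _,
    Classical.decEq _, gadget _ _, ?_, ⟨?_⟩⟩
  · refine gadget_isTree (f.isTree_iff.2 hG) fun x y hxy hx hy => ?_
    exact h ⟨f x, f y, f.map_adj_iff.2 hxy, hx.map_iso f, hy.map_iso f⟩
  · refine @gadgetIso _ _ _ _ _ (f.isTree_iff.2 hG) (fun x y hxy hx hy => ?_)
      fun x a b c hx ha hb hc => ?_
    · exact h ⟨f x, f y, f.map_adj_iff.2 hxy, hx.map_iso f, hy.map_iso f⟩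
    · by_contra! hne
      exact hx ⟨a, b, c, ha, hb, hc, hne.1, hne.2.1, hne.2.2⟩

theorem IsGammaGraphOfTree.not_exists (hG : G.IsTree) (h : G.IsGammaGraphOfTree) :
    ¬ ∃ x y, G.Adj x y ∧ G.HasThreeNbrs x ∧ G.HasThreeNbrs y := by
  obtain ⟨W, _, _, T, hT, ⟨f⟩⟩ := h
  rintro ⟨x, y, hxy, hx, hy⟩
  obtain ⟨a, b, ha, hb, hab, hay, hby⟩ := (hx.map_iso f).exists_pair (f y)
  obtain ⟨c, d, hc, hd, hcd, hcx, hdx⟩ := (hy.map_iso f).exists_pair (f x)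
  exact gammaGraph_not_adj_of_three hT (f.isTree_iff.1 hG) (f.map_adj_iff.2 hxy) ha hb hay.symm
    hby.symm hab hc hd hcx.symm hdx.symm hcd

theorem treeH_adj_iff {i j : Fin 6} : treeH.Adj i j ↔
    (s(i, j) = s(0, 1) ∨ s(i, j) = s(0, 2) ∨ s(i, j) = s(0, 3) ∨ s(i, j) = s(1, 4) ∨
      s(i, j) = s(1, 5)) ∧ i ≠ j := by
  simp [treeH, fromEdgeSet_adj]

/-- For the converse, two further neighbours are picked at each end of the edge; the two pairs are
disjoint because a tree has no triangle. -/
theorem treeH_isContained_iff (hG : G.IsTree) :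
    treeH.IsContained G ↔ ∃ x y, G.Adj x y ∧ G.HasThreeNbrs x ∧ G.HasThreeNbrs y := by
  constructor
  · rintro ⟨f, hf⟩
    have hadj : ∀ i j, treeH.Adj i j → G.Adj (f i) (f j) := fun i j h => f.map_adj h
    have hne : ∀ i j, i ≠ j → f i ≠ f j := fun i j h => hf.ne h
    have ht : ∀ i j : Fin 6, (s(i, j) = s(0, 1) ∨ s(i, j) = s(0, 2) ∨ s(i, j) = s(0, 3) ∨
      s(i, j) = s(1, 4) ∨ s(i, j) = s(1, 5)) ∧ i ≠ j → G.Adj (f i) (f j) :=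
      fun i j h => hadj i j (treeH_adj_iff.2 h)
    exact ⟨f 0, f 1, ht _ _ (by decide),
      ⟨f 1, f 2, f 3, ht _ _ (by decide), ht _ _ (by decide), ht _ _ (by decide),
        hne _ _ (by decide), hne _ _ (by decide), hne _ _ (by decide)⟩,
      ⟨f 0, f 4, f 5, ht _ _ (by decide), ht _ _ (by decide), ht _ _ (by decide),
        hne _ _ (by decide), hne _ _ (by decide), hne _ _ (by decide)⟩⟩
  · rintro ⟨x, y, hxy, hx, hy⟩
    obtain ⟨a, b, ha, hb, hab, hay, hby⟩ := hx.exists_pair y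
    obtain ⟨c, d, hc, hd, hcd, hcx, hdx⟩ := hy.exists_pair x
    have hdisj : ∀ {p q}, G.Adj x p → G.Adj y q → p ≠ q := by
      rintro p _ hp hq rfl
      exact hG.not_triangle hxy hp hq
    have h1 := hdisj ha hc
    have h2 := hdisj ha hd
    have h3 := hdisj hb hc
    have h4 := hdisj hb hd
    have hxy' := hxy.ne
    have hxa := ha.ne
    have hxb := hb.ne
    have hyc := hc.ne
    have hyd := hd.ne
    refine ⟨⟨⟨![x, y, a, b, c, d], fun {i j} hij => ?_⟩, ?_⟩⟩
    · rw [treeH_adj_iff] at hij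
      fin_cases i <;> fin_cases j <;> first
        | exact absurd hij (by decide)
        | simpa [adj_comm] using by assumption
    · intro i j hij
      fin_cases i <;> fin_cases j <;> first | rfl | (simp at hij; grind)

end Main

end SimpleGraph

theorem mainTheorem1 {V : Type*} [Fintype V] (G : SimpleGraph V) [DecidableRel G.Adj]
    (hG : G.IsTree) :
    (G.IsGammaGraphOfTree ↔ ¬ SimpleGraph.treeH.IsContained G) ∧
    (G.IsGammaGraphOfTree ↔ ¬ ∃ x y : V, G.Adj x y ∧ 3 ≤ G.degree x ∧ 3 ≤ G.degree y) := by
  simp only [SimpleGraph.three_le_degree_iff]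
  rw [SimpleGraph.treeH_isContained_iff hG]
  have h : G.IsGammaGraphOfTree ↔
      ¬ ∃ x y, G.Adj x y ∧ G.HasThreeNbrs x ∧ G.HasThreeNbrs y :=
    ⟨fun h => h.not_exists hG, SimpleGraph.isGammaGraphOfTree_of_not_exists hG⟩
  exact ⟨h, h⟩
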